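/- Let $(\pi^n)_{n\in\mathbb N}$ be a sequence of pairwise distinct probability distributions $\pi^n=(\pi^n_i)_{i\in\mathbb N}$ on $\mathbb N=\{0,1,2,\dots\}$, with $\pi^n$ supported in $\{0,\dots,n\}$. Set $d_{-1,-1}=0$, $d_{-1,j}=d_{j,-1}=1$ for $j\in\mathbb N$ and, recursively for $m,n\in\mathbb N$, $$d_{m,n}=\min_{z\in\mathcal F_{m,n}}C_{m,n}(z),\qquad C_{m,n}(z)=\sum_{i=0}^m\sum_{j=0}^n z_{i,j}\,d_{i-1,j-1},$$ where $\mathcal F_{m,n}$ is the set of transport plans from $\pi^m$ to $\pi^n$, that is, of all arrays $z=(z_{i,j})_{0\le i\le m,\,0\le j\le n}$ with $z_{i,j}\ge 0$, $\sum_{j=0}^n z_{i,j}=\pi^m_i$ for all $i\le m$ and $\sum_{i=0}^m z_{i,j}=\pi^n_j$ for all $j\le n$. Assume condition (H): for every $n\ge1$, $\pi^n_n>0$ and $0\le\pi^n_i\le\pi^{n-1}_i$ for all $i<n$. Then: (1) $d$ satisfies the convex quadrangle inequality: for all integers $-1\le i\le j\le k\le l$, $$d_{i,l}+d_{j,k}\le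 d_{i,k}+d_{j,l}.$$ (2) For all $m,n\in\mathbb N$ with $m\le n$, the Inside-Out algorithm on input $\pi^m,\pi^n$ computes an optimal transport for $d_{m,n}$: its output $z$ belongs to $\mathcal F_{m,n}$, minimizes $C_{m,n}$ over $\mathcal F_{m,n}$, and $C_{m,n}(z)=d_{m,n}$. Moreover $z$ is simple, i.e. $z_{i,i}=\min\{\pi^m_i,\pi^n_i\}$ for all $i\le m$, and nested, i.e. there are no $i<j<k<l$ with $z_{i,k}>0$ and $z_{j,l}>0$. Here the Inside-Out algorithm is the following greedy procedure. First, for each $i\le m$, set $z_{i,i}=\pi^n_i$ and $z_{j,i}=0$ for $j\ne i$, and let the residual supply of $i$ be $\sigma_i=\pi^m_i-\pi^n_i$; the unmet demand of each $j\in\{m+1,\dots,n\}$ is initially $\pi^n_j$. Then process the sources $i=m,m-1,\dots,0$ in this order; for each of them go through the destinations $j=m+1,m+2,\dots,n$ in increasing order, ship from $i$ to $j$ the minimum of the residual supply of $i$ and the unmet demand of $j$, let $z_{i,j}$ be this amount, and subtract it from both. -/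

import Mathlib

/-- A sequence `(π^n)` of pairwise distinct probability distributions on `ℕ`, the `n`-th one
being supported in `{0, …, n}`; the mass of `π^n` at `i` is written `π n i`. -/
structure IsDistributionSequence (π : ℕ → ℕ → ℝ) : Prop where
  nonneg : ∀ n i, 0 ≤ π n i
  support : ∀ n i, n < i → π n i = 0
  sum_eq_one : ∀ n, ∑ i ∈ Finset.range (n + 1), π n i = 1
  distinct : ∀ m n, m ≠ n → π m ≠ π n

/-- The drift condition (H). -/
def DriftCondition (π : ℕ → ℕ → ℝ) : Prop :=
  ∀ n, 1 ≤ n → 0 < π n n ∧ ∀ i, i < n → 0 ≤ π n i ∧ π n i ≤ π (n - 1) i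

/-- `z` is a transport plan from `π^m` to `π^n`, i.e. an element of the polytope `F_{m,n}`.
The `(m + 1) × (n + 1)` array `z` is extended by zero to all pairs of natural numbers. -/
structure IsTransportPlan (π : ℕ → ℕ → ℝ) (m n : ℕ) (z : ℕ → ℕ → ℝ) : Prop where
  nonneg : ∀ i j, 0 ≤ z i j
  support : ∀ i j, m < i ∨ n < j → z i j = 0
  row_sum : ∀ i, i ≤ m → ∑ j ∈ Finset.range (n + 1), z i j = π m i
  col_sum : ∀ j, j ≤ n → ∑ i ∈ Finset.range (m + 1), z i j = π n j

/-- The recursive optimal transport costs with both indices shifted by one: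
`shiftedDist π a b` is `d_{a-1,b-1}`. -/
noncomputable def shiftedDist (π : ℕ → ℕ → ℝ) : ℕ → ℕ → ℝ
  | 0, 0 => 0
  | 0, _ + 1 => 1
  | _ + 1, 0 => 1
  | m + 1, n + 1 =>
      sInf {c : ℝ | ∃ z : ℕ → ℕ → ℝ, IsTransportPlan π m n z ∧
        c = ∑ i : Fin (m + 1), ∑ j : Fin (n + 1), z i j * shiftedDist π i j}
termination_by m => m

/-- The recursive optimal transport metric `d_{m,n}` for integers `m, n ≥ -1`
(its values at integers below `-1` are irrelevant). -/
noncomputable def otDist (π : ℕ → ℕ → ℝ) (m n : ℤ) : ℝ :=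
  shiftedDist π (m + 1).toNat (n + 1).toNat

/-- The cost `C_{m,n}(z) = ∑_{i ≤ m} ∑_{j ≤ n} z_{i,j} d_{i-1,j-1}`. -/
noncomputable def transportCost (π : ℕ → ℕ → ℝ) (m n : ℕ) (z : ℕ → ℕ → ℝ) : ℝ :=
  ∑ i ∈ Finset.range (m + 1), ∑ j ∈ Finset.range (n + 1),
    z i j * otDist π ((i : ℤ) - 1) ((j : ℤ) - 1)

theorem otDist_neg_one_neg_one (π : ℕ → ℕ → ℝ) : otDist π (-1) (-1) = 0 := by
  simp [otDist, shiftedDist]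

theorem otDist_neg_one_natCast (π : ℕ → ℕ → ℝ) (n : ℕ) : otDist π (-1) n = 1 := by
  have h : ((n : ℤ) + 1).toNat = n + 1 := by omega
  simp [otDist, h, shiftedDist]

theorem otDist_natCast_neg_one (π : ℕ → ℕ → ℝ) (m : ℕ) : otDist π m (-1) = 1 := by
  have h : ((m : ℤ) + 1).toNat = m + 1 := by omega
  simp [otDist, h, shiftedDist]

/-- The defining recursion of `d_{m,n}` for `m, n ∈ ℕ`. -/
theorem otDist_natCast (π : ℕ → ℕ → ℝ) (m n : ℕ) :
    otDist π m n =
      sInf {c : ℝ | ∃ z : ℕ → ℕ → ℝ, IsTransportPlan π m n z ∧ c = transportCost π m n z} := by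
  have hm : ((m : ℤ) + 1).toNat = m + 1 := by omega
  have hn : ((n : ℤ) + 1).toNat = n + 1 := by omega
  rw [otDist, hm, hn, shiftedDist]
  simp [transportCost, otDist, Finset.sum_range]

/-- `z` is an optimal solution of the transport problem `P_{m,n}`. -/
def IsOptimalTransport (π : ℕ → ℕ → ℝ) (m n : ℕ) (z : ℕ → ℕ → ℝ) : Prop :=
  IsTransportPlan π m n z ∧
    ∀ w : ℕ → ℕ → ℝ, IsTransportPlan π m n w → transportCost π m n z ≤ transportCost π m n w

/-- A transport from `π^m` to `π^n` (with `m ≤ n`) is simple if as much mass as possible stays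
in place. -/
def IsSimplePlan (π : ℕ → ℕ → ℝ) (m n : ℕ) (z : ℕ → ℕ → ℝ) : Prop :=
  ∀ i, i ≤ m → z i i = min (π m i) (π n i)

/-- A transport is nested if its flows do not intersect. -/
def IsNestedPlan (z : ℕ → ℕ → ℝ) : Prop :=
  ¬ ∃ i j k l : ℕ, i < j ∧ j < k ∧ k < l ∧ 0 < z i k ∧ 0 < z j l

/-- State of the Inside-Out algorithm: the flows assigned so far, the residual supply of each
source node and the unmet demand of each destination node. -/
structure InsideOutState where
  flow : ℕ → ℕ → ℝ
  supply : ℕ → ℝ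
  demand : ℕ → ℝ

namespace InsideOut

/-- First step: fill each demand `i ≤ m` from the supply `i`; the residual supplies are
`σ_i = π_i^m - π_i^n`, and the unmet demands are those at the nodes beyond `m`. -/
noncomputable def init (π : ℕ → ℕ → ℝ) (m n : ℕ) : InsideOutState where
  flow := fun i j => if i = j ∧ i ≤ m then π n i else 0
  supply := fun i => if i ≤ m then π m i - π n i else 0
  demand := fun j => if j ≤ m then 0 else π n j

/-- Ship from `i` to `j` as much as the residual supply of `i` and the unmet demand of `j`
allow. -/
noncomputable def ship (i j : ℕ) (S : InsideOutState) : InsideOutState where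
  flow := fun a b =>
    if a = i ∧ b = j then S.flow i j + min (S.supply i) (S.demand j) else S.flow a b
  supply := fun a =>
    if a = i then S.supply i - min (S.supply i) (S.demand j) else S.supply a
  demand := fun b =>
    if b = j then S.demand j - min (S.supply i) (S.demand j) else S.demand b

/-- Use the residual supply of `i` to fill the unmet demands at `m + 1, m + 2, …, n`,
in this order. -/
noncomputable def fillFrom (m n i : ℕ) (S : InsideOutState) : InsideOutState :=
  (List.range (n - m)).foldl (fun T c => ship i (m + 1 + c) T) S

/-- The final state: after the first step the sources `m, m - 1, …, 0` are processed,
in this order. -/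
noncomputable def run (π : ℕ → ℕ → ℝ) (m n : ℕ) : InsideOutState :=
  (List.range (m + 1)).foldl (fun S r => fillFrom m n (m - r) S) (init π m n)

end InsideOut

/-- The array of flows computed by the Inside-Out algorithm on input `π^m`, `π^n`
(with `m ≤ n`). -/
noncomputable def insideOutPlan (π : ℕ → ℕ → ℝ) (m n : ℕ) : ℕ → ℕ → ℝ :=
  (InsideOut.run π m n).flow

/-! Write D for `shiftedDist π`. Summing mixed second differences expresses D(p, q), for p ≤ q ≤ N,
as boundary terms minus the sum of `mixedDiff D i j` over i < p, q ≤ j < N. Extended to all p, q ≤ N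
with the extra condition i < q, this expression (`kernel`) stays below D when the differences above
the diagonal are nonnegative and D(·, N) is antitone. A plan z therefore costs at least a constant,
fixed by the marginals, minus the sum of `mixedDiff D i j` times its `middleFlow` at (i, j), and
`middleFlow` is at most the minimum of `upperMass` and `middleMass`. The Inside-Out plan ships only
upward or in place and is nested, so it attains all these bounds at once
(`middleFlow_insideOutPlan`). It is thus optimal, with value `transportValue`.

The argument closes by induction on N (`QuadrangleUpTo.succ`): the inequalities up to N give this
formula for D at indices up to N + 1. Supermodularity of the minimum, with `upperMass` increasing in
m and `middleMass` decreasing in n, then yields the inequalities up to N + 1. -/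

theorem DriftCondition.le_of_le {π : ℕ → ℕ → ℝ} (hH : DriftCondition π) {m n i : ℕ}
    (hi : i ≤ m) (hmn : m ≤ n) : π n i ≤ π m i := by
  induction n, hmn using Nat.le_induction with
  | base => exact le_rfl
  | succ n hn ih => exact ((hH (n + 1) (by omega)).2 i (by omega)).2.trans ih

/-! ### Invariants of the Inside-Out algorithm. -/

namespace InsideOut

/-- The state of the algorithm after the pairs in `P` have been served. -/
structure Invariant (π : ℕ → ℕ → ℝ) (m n : ℕ) (P : ℕ → ℕ → Prop) (S : InsideOutState) :
    Prop where
  flow_nonneg : ∀ i j, 0 ≤ S.flow i j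
  supply_nonneg : ∀ i, 0 ≤ S.supply i
  demand_nonneg : ∀ j, 0 ≤ S.demand j
  support : ∀ i j, S.flow i j ≠ 0 → (i = j ∧ i ≤ m) ∨ (P i j ∧ i ≤ m ∧ m < j ∧ j ≤ n)
  diag : ∀ i, i ≤ m → S.flow i i = π n i
  row : ∀ i, i ≤ m → ∑ j ∈ Finset.range (n + 1), S.flow i j + S.supply i = π m i
  col : ∀ j, j ≤ n → ∑ i ∈ Finset.range (m + 1), S.flow i j + S.demand j = π n j
  demand_of_le : ∀ j, j ≤ m → S.demand j = 0
  -- Greediness: a served pair leaves one side empty. This yields `demand_of_flow`, which in turn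
  -- preserves `nested`.
  exhausted : ∀ i j, P i j → i ≤ m → m < j → j ≤ n → S.supply i = 0 ∨ S.demand j = 0
  demand_of_flow : ∀ i k l, m < k → k < l → S.flow i l ≠ 0 → S.demand k = 0
  nested : ∀ i j k l, i < j → m < k → k < l → S.flow i k ≠ 0 → S.flow j l = 0

theorem invariant_init {π : ℕ → ℕ → ℝ} (hπ : IsDistributionSequence π) (hH : DriftCondition π)
    {m n : ℕ} (hmn : m ≤ n) : Invariant π m n (fun _ _ => False) (init π m n) where
  flow_nonneg i j := by
    simp only [init]; split_ifs
    exacts [hπ.nonneg _ _, le_rfl]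
  supply_nonneg i := by
    simp only [init]; split_ifs with h
    exacts [sub_nonneg.2 (hH.le_of_le h hmn), le_rfl]
  demand_nonneg j := by
    simp only [init]; split_ifs
    exacts [le_rfl, hπ.nonneg _ _]
  support i j h := by
    simp only [init, ne_eq, ite_eq_right_iff, Classical.not_imp] at h
    exact Or.inl h.1
  diag i hi := by simp [init, hi]
  row i hi := by
    have h : i < n + 1 := by omega
    simp [init, hi, h]
  col j hj := by
    by_cases h : j ≤ m
    · have h' : ∀ i, (i = j ∧ i ≤ m) ↔ i = j := fun i => by omega
      have h'' : j < m + 1 := by omega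
      simp [init, h, h', h'']
    · have h' : ∀ i, ¬ (i = j ∧ i ≤ m) := fun i => by omega
      simp [init, h, h']
  demand_of_le j hj := by simp [init, hj]
  exhausted i j h := h.elim
  demand_of_flow i k l hk hl h := by
    have : ¬ (i = l ∧ i ≤ m) := by omega
    simp [init, this] at h
  nested i j k l _ hk _ h := by
    have : ¬ (i = k ∧ i ≤ m) := by omega
    simp [init, this] at h

/-- The processing order enters through `hprev` (nearer destinations come first) and `hlow` (lower
sources come later). The former shows that a positive shipment leaves no unmet demand nearer by; the
latter excludes a crossing with an earlier flow from a lower source. -/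
theorem Invariant.ship {π : ℕ → ℕ → ℝ} {m n : ℕ} {P : ℕ → ℕ → Prop} {S : InsideOutState}
    (h : Invariant π m n P S) {a b : ℕ} (ha : a ≤ m) (hmb : m < b) (hb : b ≤ n)
    (hprev : ∀ k, m < k → k < b → P a k) (hlow : ∀ i k, i < a → ¬ P i k) :
    Invariant π m n (fun i j => P i j ∨ (i = a ∧ j = b)) (ship a b S) := by
  set δ := min (S.supply a) (S.demand b) with hδ
  have hδ0 : 0 ≤ δ := le_min (h.supply_nonneg a) (h.demand_nonneg b)
  have hδs : δ ≤ S.supply a := min_le_left _ _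
  have hδd : δ ≤ S.demand b := min_le_right _ _
  have hflow : ∀ i j, (InsideOut.ship a b S).flow i j =
      S.flow i j + if i = a ∧ j = b then δ else 0 := by
    intro i j
    simp only [InsideOut.ship]
    split_ifs with hc
    · rw [hc.1, hc.2]
    · simp
  have hsup : ∀ i, (InsideOut.ship a b S).supply i = S.supply i - if i = a then δ else 0 := by
    intro i
    simp only [InsideOut.ship]
    split_ifs with hc
    · rw [hc]
    · simp
  have hdem : ∀ j, (InsideOut.ship a b S).demand j = S.demand j - if j = b then δ else 0 := by
    intro j
    simp only [InsideOut.ship]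
    split_ifs with hc
    · rw [hc]
    · simp
  have hsup0 : ∀ i, 0 ≤ (InsideOut.ship a b S).supply i := fun i => by
    rw [hsup]; split_ifs with hc
    · rw [hc]; linarith
    · simpa using h.supply_nonneg i
  have hdem0 : ∀ j, 0 ≤ (InsideOut.ship a b S).demand j := fun j => by
    rw [hdem]; split_ifs with hc
    · rw [hc]; linarith
    · simpa using h.demand_nonneg j
  have hsupz : ∀ i, S.supply i = 0 → (InsideOut.ship a b S).supply i = 0 := fun i hi =>
    le_antisymm (by rw [hsup, hi]; split_ifs <;> linarith) (hsup0 i)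
  have hdemz : ∀ j, S.demand j = 0 → (InsideOut.ship a b S).demand j = 0 := fun j hj =>
    le_antisymm (by rw [hdem, hj]; split_ifs <;> linarith) (hdem0 j)
  have hnew : ∀ i j, (InsideOut.ship a b S).flow i j ≠ 0 →
      S.flow i j ≠ 0 ∨ (i = a ∧ j = b ∧ δ ≠ 0) := by
    intro i j hij
    rw [hflow] at hij
    by_contra! hc
    by_cases hab : i = a ∧ j = b
    · rw [hc.1, if_pos hab, hc.2 hab.1 hab.2] at hij; simp at hij
    · rw [hc.1, if_neg hab] at hij; simp at hij
  have hbelow : δ ≠ 0 → ∀ k, m < k → k < b → S.demand k = 0 := by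
    intro hδn k hk hkb
    refine (h.exhausted a k (hprev k hk hkb) ha hk (by omega)).resolve_left fun hs => hδn ?_
    exact le_antisymm (hs ▸ hδs) hδ0
  refine ⟨fun i j => ?_, hsup0, hdem0, ?_, ?_, ?_, ?_, ?_, ?_, ?_, ?_⟩
  · rw [hflow]
    have := h.flow_nonneg i j
    split_ifs <;> linarith
  · intro i j hij
    rcases hnew i j hij with h1 | ⟨rfl, rfl, -⟩
    · rcases h.support i j h1 with h2 | h2
      exacts [Or.inl h2, Or.inr ⟨Or.inl h2.1, h2.2⟩]
    · exact Or.inr ⟨Or.inr ⟨rfl, rfl⟩, ha, hmb, hb⟩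
  · intro i hi
    have : ¬ (i = a ∧ i = b) := by omega
    rw [hflow, if_neg this, add_zero, h.diag i hi]
  · intro i hi
    have hb' : b < n + 1 := by omega
    have := h.row i hi
    simp only [hflow, hsup, Finset.sum_add_distrib]
    by_cases hc : i = a
    · simp only [hc, true_and, Finset.sum_ite_eq', Finset.mem_range, hb', if_true] at this ⊢
      linarith
    · simp only [hc, false_and, if_false, Finset.sum_const_zero] at this ⊢
      linarith
  · intro j hj
    have ha' : a < m + 1 := by omega
    have := h.col j hj
    simp only [hflow, hdem, Finset.sum_add_distrib]
    by_cases hc : j = b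
    · simp only [hc, and_true, Finset.sum_ite_eq', Finset.mem_range, ha', if_true] at this ⊢
      linarith
    · simp only [hc, and_false, if_false, Finset.sum_const_zero] at this ⊢
      linarith
  · exact fun j hj => hdemz j (h.demand_of_le j hj)
  · rintro i j (hP | ⟨rfl, rfl⟩) hi hmj hj
    · exact (h.exhausted i j hP hi hmj hj).imp (hsupz i) (hdemz j)
    · rw [hsup, hdem, if_pos rfl, if_pos rfl, sub_eq_zero, sub_eq_zero]
      exact (min_choice (S.supply i) (S.demand j)).imp Eq.symm Eq.symm
  · intro i k l hk hkl hil
    rcases hnew i l hil with h1 | ⟨rfl, rfl, h1⟩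
    · exact hdemz k (h.demand_of_flow i k l hk hkl h1)
    · exact hdemz k (hbelow h1 k hk hkl)
  · intro i j k l hij hk hkl hik
    by_contra hjl
    rcases hnew i k hik with h1 | ⟨rfl, rfl, h1⟩
    · rcases hnew j l hjl with h2 | ⟨rfl, rfl, h2⟩
      · exact h2 (h.nested i j k l hij hk hkl h1)
      · rcases h.support i k h1 with h3 | h3
        · omega
        · exact hlow i k hij h3.1
    · rcases hnew j l hjl with h2 | ⟨rfl, rfl, h2⟩
      · have := h.demand_of_flow j k l hk hkl h2
        exact h1 (le_antisymm (this ▸ hδd) hδ0)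
      · omega

theorem Invariant.congr {π : ℕ → ℕ → ℝ} {m n : ℕ} {P Q : ℕ → ℕ → Prop} {S : InsideOutState}
    (h : Invariant π m n P S) (hPQ : ∀ i j, i ≤ m → m < j → j ≤ n → (P i j ↔ Q i j)) :
    Invariant π m n Q S where
  flow_nonneg := h.flow_nonneg
  supply_nonneg := h.supply_nonneg
  demand_nonneg := h.demand_nonneg
  support i j hij := (h.support i j hij).imp_right
    fun ⟨h1, h2, h3, h4⟩ => ⟨(hPQ i j h2 h3 h4).1 h1, h2, h3, h4⟩
  diag := h.diag
  row := h.row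
  col := h.col
  demand_of_le := h.demand_of_le
  exhausted i j hP hi hmj hj := h.exhausted i j ((hPQ i j hi hmj hj).2 hP) hi hmj hj
  demand_of_flow := h.demand_of_flow
  nested := h.nested

theorem Invariant.fillFrom {π : ℕ → ℕ → ℝ} {m n a : ℕ} {S : InsideOutState} (ha : a ≤ m)
    (h : Invariant π m n (fun i _ => a < i) S) :
    Invariant π m n (fun i _ => a ≤ i) (fillFrom m n a S) := by
  have key : ∀ c, c ≤ n - m → Invariant π m n (fun i j => a < i ∨ (i = a ∧ j < m + 1 + c))
      ((List.range c).foldl (fun T c => InsideOut.ship a (m + 1 + c) T) S) := by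
    intro c
    induction c with
    | zero => exact fun _ => h.congr fun i j _ _ _ => by omega
    | succ c ih =>
      intro hc
      rw [List.range_succ, List.foldl_append]
      refine ((ih (by omega)).ship ha (by omega) (by omega) (fun k _ _ => by omega)
        (fun i k _ => by omega)).congr fun i j _ _ _ => by omega
  exact (key (n - m) le_rfl).congr fun i j _ _ _ => by omega

theorem invariant_run {π : ℕ → ℕ → ℝ} (hπ : IsDistributionSequence π) (hH : DriftCondition π)
    {m n : ℕ} (hmn : m ≤ n) : Invariant π m n (fun _ _ => True) (run π m n) := by
  have key : ∀ r, r ≤ m + 1 → Invariant π m n (fun i _ => m < i + r)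
      ((List.range r).foldl (fun S r => InsideOut.fillFrom m n (m - r) S) (init π m n)) := by
    intro r
    induction r with
    | zero => exact fun _ => (invariant_init hπ hH hmn).congr fun i j _ _ _ => by simp; omega
    | succ r ih =>
      intro hr
      rw [List.range_succ, List.foldl_append]
      exact ((ih (by omega)).congr fun i j _ _ _ => by omega).fillFrom (a := m - r) (by omega)
        |>.congr fun i j _ _ _ => by omega
  exact (key (m + 1) le_rfl).congr fun i j _ _ _ => by simp; omega

/-- Both marginals have mass one, so total residual supply equals total unmet demand. A source with
supply left would force every demand to vanish, hence both totals. -/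
theorem run_supply_demand {π : ℕ → ℕ → ℝ} (hπ : IsDistributionSequence π)
    (hH : DriftCondition π) {m n : ℕ} (hmn : m ≤ n) :
    (∀ i ≤ m, (run π m n).supply i = 0) ∧ ∀ j ≤ n, (run π m n).demand j = 0 := by
  have h := invariant_run hπ hH hmn
  set S := run π m n
  have htotal : ∑ i ∈ Finset.range (m + 1), S.supply i
      = ∑ j ∈ Finset.range (n + 1), S.demand j := by
    have h1 := Finset.sum_congr (Eq.refl (Finset.range (m + 1)))
      fun i hi => h.row i (Nat.lt_succ_iff.1 (Finset.mem_range.1 hi))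
    have h2 := Finset.sum_congr (Eq.refl (Finset.range (n + 1)))
      fun j hj => h.col j (Nat.lt_succ_iff.1 (Finset.mem_range.1 hj))
    rw [Finset.sum_add_distrib, hπ.sum_eq_one] at h1 h2
    rw [Finset.sum_comm] at h2
    linarith
  have hs : ∀ i ∈ Finset.range (m + 1), 0 ≤ S.supply i := fun i _ => h.supply_nonneg i
  have hd : ∀ j ∈ Finset.range (n + 1), 0 ≤ S.demand j := fun j _ => h.demand_nonneg j
  have hzero : ∑ i ∈ Finset.range (m + 1), S.supply i = 0 := by
    by_contra hne
    obtain ⟨i, hi, hi0⟩ := Finset.exists_ne_zero_of_sum_ne_zero hne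
    refine hne (htotal.trans (Finset.sum_eq_zero fun j hj => ?_))
    rw [Finset.mem_range] at hi hj
    by_cases hjm : j ≤ m
    · exact h.demand_of_le j hjm
    · exact (h.exhausted i j trivial (by omega) (by omega) (by omega)).resolve_left hi0
  constructor
  · intro i hi
    exact (Finset.sum_eq_zero_iff_of_nonneg hs).1 hzero i (Finset.mem_range.2 (by omega))
  · intro j hj
    exact (Finset.sum_eq_zero_iff_of_nonneg hd).1 (htotal ▸ hzero) j
      (Finset.mem_range.2 (by omega))

end InsideOut

/-! ### Feasibility, simplicity and nestedness of the computed plan. -/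

theorem insideOutPlan_support {π : ℕ → ℕ → ℝ} (hπ : IsDistributionSequence π)
    (hH : DriftCondition π) {m n : ℕ} (hmn : m ≤ n)
    {i j : ℕ} (h : insideOutPlan π m n i j ≠ 0) :
    (i = j ∧ i ≤ m) ∨ (i ≤ m ∧ m < j ∧ j ≤ n) :=
  ((InsideOut.invariant_run hπ hH hmn).support i j h).imp_right And.right

theorem isTransportPlan_insideOutPlan {π : ℕ → ℕ → ℝ} (hπ : IsDistributionSequence π)
    (hH : DriftCondition π) {m n : ℕ} (hmn : m ≤ n) : IsTransportPlan π m n (insideOutPlan π m n) where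
  nonneg := (InsideOut.invariant_run hπ hH hmn).flow_nonneg
  support i j hij := by
    by_contra h
    have := insideOutPlan_support hπ hH hmn h
    omega
  row_sum i hi := by
    have h := (InsideOut.invariant_run hπ hH hmn).row i hi
    rwa [(InsideOut.run_supply_demand hπ hH hmn).1 i hi, add_zero] at h
  col_sum j hj := by
    have h := (InsideOut.invariant_run hπ hH hmn).col j hj
    rwa [(InsideOut.run_supply_demand hπ hH hmn).2 j hj, add_zero] at h

theorem isSimplePlan_insideOutPlan {π : ℕ → ℕ → ℝ} (hπ : IsDistributionSequence π)
    (hH : DriftCondition π) {m n : ℕ} (hmn : m ≤ n) : IsSimplePlan π m n (insideOutPlan π m n) := fun i hi => by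
  rw [min_eq_right (hH.le_of_le hi hmn)]
  exact (InsideOut.invariant_run hπ hH hmn).diag i hi

theorem insideOutPlan_eq_zero_of_crossing {π : ℕ → ℕ → ℝ} (hπ : IsDistributionSequence π)
    (hH : DriftCondition π) {m n : ℕ} (hmn : m ≤ n)
    {i j k l : ℕ} (hij : i < j) (hjk : j < k) (hkl : k < l)
    (hik : insideOutPlan π m n i k ≠ 0) : insideOutPlan π m n j l = 0 := by
  by_contra hjl
  have h1 := insideOutPlan_support hπ hH hmn hik
  exact hjl ((InsideOut.invariant_run hπ hH hmn).nested i j k l hij (by omega) hkl hik)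

theorem isNestedPlan_insideOutPlan {π : ℕ → ℕ → ℝ} (hπ : IsDistributionSequence π)
    (hH : DriftCondition π) {m n : ℕ} (hmn : m ≤ n) : IsNestedPlan (insideOutPlan π m n) := by
  rintro ⟨i, j, k, l, hij, hjk, hkl, h1, h2⟩
  exact h2.ne' (insideOutPlan_eq_zero_of_crossing hπ hH hmn hij hjk hkl h1.ne')

/-! ### Tail and interval masses, and the flow bounds they impose. -/

/-- The mass of `π^m` at the nodes beyond `i`. -/
def upperMass (π : ℕ → ℕ → ℝ) (m i : ℕ) : ℝ :=
  ∑ p ∈ Finset.range (m + 1), if i < p then π m p else 0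

/-- The mass of `π^n` at the nodes in `(i, j]`. -/
def middleMass (π : ℕ → ℕ → ℝ) (n i j : ℕ) : ℝ :=
  ∑ q ∈ Finset.range (n + 1), if i < q ∧ q ≤ j then π n q else 0

/-- The mass that `z` ships from the sources beyond `i` to the destinations in `(i, j]`. -/
def middleFlow (m n : ℕ) (z : ℕ → ℕ → ℝ) (i j : ℕ) : ℝ :=
  ∑ p ∈ Finset.range (m + 1), ∑ q ∈ Finset.range (n + 1),
    if i < p ∧ i < q ∧ q ≤ j then z p q else 0

section Masses

variable {π : ℕ → ℕ → ℝ}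

theorem upperMass_nonneg (hπ : IsDistributionSequence π) (m i : ℕ) : 0 ≤ upperMass π m i :=
  Finset.sum_nonneg fun p _ => by split_ifs; exacts [hπ.nonneg _ _, le_rfl]

theorem middleMass_nonneg (hπ : IsDistributionSequence π) (n i j : ℕ) : 0 ≤ middleMass π n i j :=
  Finset.sum_nonneg fun p _ => by split_ifs; exacts [hπ.nonneg _ _, le_rfl]

theorem upperMass_eq (hπ : IsDistributionSequence π) (m i : ℕ) :
    upperMass π m i = 1 - ∑ p ∈ Finset.range (m + 1), if p ≤ i then π m p else 0 := by
  rw [eq_sub_iff_add_eq, upperMass, ← Finset.sum_add_distrib, ← hπ.sum_eq_one m]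
  refine Finset.sum_congr rfl fun p _ => ?_
  by_cases h : i < p
  · simp [h, not_le.2 h]
  · simp [h, not_lt.1 h]

theorem upperMass_eq_zero {m i : ℕ} (h : m ≤ i) : upperMass π m i = 0 :=
  Finset.sum_eq_zero fun p hp => if_neg (by rw [Finset.mem_range] at hp; omega)

/-- By (H) every old node can only lose mass when `m` grows, so the mass at nodes up to `i < m + 1`
shrinks and its complement grows. -/
theorem upperMass_le_succ (hπ : IsDistributionSequence π) (hH : DriftCondition π) (m i : ℕ) :
    upperMass π m i ≤ upperMass π (m + 1) i := by
  by_cases h : m ≤ i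
  · rw [upperMass_eq_zero h]; exact upperMass_nonneg hπ _ _
  · have h' : ¬ m + 1 ≤ i := by omega
    rw [upperMass_eq hπ, upperMass_eq hπ, Finset.sum_range_succ _ (m + 1), if_neg h', add_zero]
    refine sub_le_sub_left (Finset.sum_le_sum fun p hp => ?_) 1
    split_ifs
    · exact hH.le_of_le (Nat.lt_succ_iff.1 (Finset.mem_range.1 hp)) (Nat.le_succ m)
    · exact le_rfl

theorem upperMass_mono (hπ : IsDistributionSequence π) (hH : DriftCondition π) (i : ℕ) :
    Monotone fun m => upperMass π m i :=
  monotone_nat_of_le_succ fun m => upperMass_le_succ hπ hH m i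

theorem middleMass_succ_le (hH : DriftCondition π) {n i j : ℕ} (hj : j ≤ n) :
    middleMass π (n + 1) i j ≤ middleMass π n i j := by
  have h : ¬ (i < n + 1 ∧ n + 1 ≤ j) := by omega
  rw [middleMass, Finset.sum_range_succ, if_neg h, add_zero]
  refine Finset.sum_le_sum fun p hp => ?_
  split_ifs
  · exact hH.le_of_le (Nat.lt_succ_iff.1 (Finset.mem_range.1 hp)) (Nat.le_succ n)
  · exact le_rfl

theorem middleMass_eq_upperMass {n i j : ℕ} (hj : n ≤ j) :
    middleMass π n i j = upperMass π n i :=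
  Finset.sum_congr rfl fun q hq => if_congr
    (by rw [Finset.mem_range] at hq; omega) rfl rfl

theorem middleMass_eq_zero {n i j : ℕ} (hj : j ≤ i) : middleMass π n i j = 0 :=
  Finset.sum_eq_zero fun q _ => if_neg (by omega)

theorem min_mass_supermodular (hπ : IsDistributionSequence π) (hH : DriftCondition π)
    {m n : ℕ} (hmn : m + 1 ≤ n) (i j : ℕ) :
    min (upperMass π m i) (middleMass π n i j)
        + min (upperMass π (m + 1) i) (middleMass π (n + 1) i j)
      ≤ min (upperMass π m i) (middleMass π (n + 1) i j)
        + min (upperMass π (m + 1) i) (middleMass π n i j) := by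
  have hA := upperMass_le_succ hπ hH m i
  by_cases hj : j ≤ n
  · have hB := middleMass_succ_le hH (i := i) hj
    rcases le_total (upperMass π (m + 1) i) (middleMass π (n + 1) i j) with h | h
    · rw [min_eq_left (hA.trans (h.trans hB)), min_eq_left h, min_eq_left (hA.trans h),
        min_eq_left (h.trans hB)]
    · rw [min_eq_right h]
      rcases le_total (upperMass π m i) (middleMass π (n + 1) i j) with h' | h'
      · rw [min_eq_left h', min_eq_left (h'.trans hB)]
        exact add_le_add_right (le_min h hB) _
      · rw [min_eq_right h', add_comm]
        exact add_le_add_right (min_le_min_right _ hA) _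
  -- For `j > n` the interval mass may grow, but it is then a full tail, which dominates the tail of
  -- the source because `m + 1 ≤ n`. All four minima are upper masses and equality holds.
  · have h1 := upperMass_mono hπ hH i hmn
    have h2 := upperMass_le_succ hπ hH n i
    simp only at h1
    rw [middleMass_eq_upperMass (n := n) (by omega),
      middleMass_eq_upperMass (n := n + 1) (by omega), min_eq_left (hA.trans h1),
      min_eq_left (h1.trans h2), min_eq_left (hA.trans (h1.trans h2)), min_eq_left h1]

theorem IsTransportPlan.middleFlow_le {m n : ℕ} {z : ℕ → ℕ → ℝ} (hz : IsTransportPlan π m n z)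
    (i j : ℕ) : middleFlow m n z i j ≤ min (upperMass π m i) (middleMass π n i j) := by
  refine le_min (Finset.sum_le_sum fun p hp => ?_) ?_
  · rw [← hz.row_sum p (Nat.lt_succ_iff.1 (Finset.mem_range.1 hp))]
    by_cases h : i < p
    · rw [if_pos h]
      refine Finset.sum_le_sum fun q _ => ?_
      split_ifs; exacts [le_rfl, hz.nonneg _ _]
    · simp [h]
  · rw [middleFlow, Finset.sum_comm]
    refine Finset.sum_le_sum fun q hq => ?_
    rw [← hz.col_sum q (Nat.lt_succ_iff.1 (Finset.mem_range.1 hq))]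
    by_cases h : i < q ∧ q ≤ j
    · rw [if_pos h]
      refine Finset.sum_le_sum fun p _ => ?_
      split_ifs; exacts [le_rfl, hz.nonneg _ _]
    · simp [h]

theorem middleFlow_insideOutPlan (hπ : IsDistributionSequence π) (hH : DriftCondition π)
    {m n : ℕ} (hmn : m ≤ n) (i j : ℕ) :
    middleFlow m n (insideOutPlan π m n) i j
      = min (upperMass π m i) (middleMass π n i j) := by
  have hz := isTransportPlan_insideOutPlan hπ hH hmn
  refine le_antisymm (hz.middleFlow_le i j) ?_
  -- If nothing goes from beyond `i` to beyond `j`, all mass beyond `i` lands in `(i, j]`, since no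
  -- flow goes down. Otherwise a flow from some `p ≤ i` into `(i, j]` would cross that shipment, so
  -- `(i, j]` is served only from beyond `i`.
  by_cases hc : ∀ p q, i < p → j < q → insideOutPlan π m n p q = 0
  · refine (min_le_left _ _).trans (Finset.sum_le_sum fun p hp => ?_)
    rw [← hz.row_sum p (Nat.lt_succ_iff.1 (Finset.mem_range.1 hp))]
    by_cases h : i < p
    · rw [if_pos h]
      refine Finset.sum_le_sum fun q _ => ?_
      split_ifs with hq
      · exact le_rfl
      · by_contra hne
        have h1 := insideOutPlan_support hπ hH hmn (i := p) (j := q) fun h0 => hne h0.le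
        exact hne (hc p q h (by omega)).le
    · simp [h]
  · push Not at hc
    obtain ⟨p', q', hp', hq', hne⟩ := hc
    refine (min_le_right _ _).trans ?_
    rw [middleFlow, Finset.sum_comm]
    refine Finset.sum_le_sum fun q hq => ?_
    rw [← hz.col_sum q (Nat.lt_succ_iff.1 (Finset.mem_range.1 hq))]
    by_cases h : i < q ∧ q ≤ j
    · rw [if_pos h]
      refine Finset.sum_le_sum fun p _ => ?_
      split_ifs with hp
      · exact le_rfl
      · by_contra hne'
        have h0 : insideOutPlan π m n p q ≠ 0 := fun h0 => hne' h0.le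
        have h1 := insideOutPlan_support hπ hH hmn h0
        have h2 := insideOutPlan_support hπ hH hmn hne
        exact hne (insideOutPlan_eq_zero_of_crossing hπ hH hmn (i := p) (k := q)
          (by omega) (by omega) (by omega) h0)
    · simp [h]

end Masses

/-! ### Representation of a cost by its mixed second differences. -/

section Telescoping

theorem sum_range_ite_lt_sub (f : ℕ → ℝ) {s N : ℕ} (h : s ≤ N) :
    ∑ i ∈ Finset.range N, (if i < s then f (i + 1) - f i else 0) = f s - f 0 := by
  rw [← Finset.sum_range_sub, ← Finset.sum_filter]
  refine Finset.sum_congr ?_ fun _ _ => rfl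
  ext i
  simp only [Finset.mem_filter, Finset.mem_range]
  omega

theorem sum_range_ite_le_sub (f : ℕ → ℝ) {q N : ℕ} (h : q ≤ N) :
    ∑ j ∈ Finset.range N, (if q ≤ j then f (j + 1) - f j else 0) = f N - f q := by
  rw [← Finset.sum_Ico_sub f h, ← Finset.sum_filter]
  refine Finset.sum_congr ?_ fun _ _ => rfl
  ext i
  simp only [Finset.mem_filter, Finset.mem_range, Finset.mem_Ico]
  omega

/-- The mixed second difference of `D`. -/
def mixedDiff (D : ℕ → ℕ → ℝ) (i j : ℕ) : ℝ :=
  D i j + D (i + 1) (j + 1) - D i (j + 1) - D (i + 1) j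

/-- The part of the cost `D` which is determined by its boundary values and by the mixed second
differences on the region above the diagonal. -/
def kernel (D : ℕ → ℕ → ℝ) (N p q : ℕ) : ℝ :=
  D 0 q + D p N - D 0 N - ∑ i ∈ Finset.range N, ∑ j ∈ Finset.range N,
    if i < p ∧ i < q ∧ q ≤ j then mixedDiff D i j else 0

theorem kernel_eq (D : ℕ → ℕ → ℝ) {N p q : ℕ} (hp : p ≤ N) (hq : q ≤ N) :
    kernel D N p q = D p N - D (min p q) N + D (min p q) q := by
  have h1 : ∀ i, (∑ j ∈ Finset.range N, if i < p ∧ i < q ∧ q ≤ j then mixedDiff D i j else 0)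
      = if i < min p q then (D (i + 1) N - D (i + 1) q) - (D i N - D i q) else 0 := by
    intro i
    by_cases hi : i < min p q
    · rw [if_pos hi, ← sum_range_ite_le_sub (D (i + 1)) hq, ← sum_range_ite_le_sub (D i) hq,
        ← Finset.sum_sub_distrib]
      refine Finset.sum_congr rfl fun j _ => ?_
      rw [lt_min_iff] at hi
      simp only [hi, true_and]
      split_ifs
      · rw [mixedDiff]; ring
      · ring
    · rw [if_neg hi]
      exact Finset.sum_eq_zero fun j _ => if_neg fun h => hi (lt_min h.1 h.2.1)
  rw [kernel, Finset.sum_congr rfl fun i _ => h1 i,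
    sum_range_ite_lt_sub (fun i => D i N - D i q) (min_le_of_left_le hp)]
  ring

/-- The elementary convex quadrangle inequalities of `D` on `{0, …, N}` together with the
monotonicity of `D(·, N)`. -/
structure QuadrangleUpTo (D : ℕ → ℕ → ℝ) (N : ℕ) : Prop where
  mixedDiff_nonneg : ∀ i j, i < j → j < N → 0 ≤ mixedDiff D i j
  anti : ∀ i, i < N → D (i + 1) N ≤ D i N

theorem QuadrangleUpTo.anti_of_le {D : ℕ → ℕ → ℝ} {N : ℕ} (h : QuadrangleUpTo D N) {p q : ℕ}
    (hpq : p ≤ q) (hq : q ≤ N) : D q N ≤ D p N := by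
  induction q, hpq using Nat.le_induction with
  | base => exact le_rfl
  | succ q _ ih => exact (h.anti q (by omega)).trans (ih (by omega))

theorem QuadrangleUpTo.kernel_le {D : ℕ → ℕ → ℝ} {N : ℕ} (h : QuadrangleUpTo D N)
    (h0 : ∀ i j, 0 ≤ D i j) (hd : ∀ i, D i i = 0) {p q : ℕ} (hp : p ≤ N) (hq : q ≤ N) :
    kernel D N p q ≤ D p q := by
  rw [kernel_eq D hp hq]
  rcases le_total p q with hpq | hpq
  -- Below the diagonal, `kernel` equals `D p N - D q N`, which is nonpositive.
  · rw [min_eq_left hpq]; linarith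
  · rw [min_eq_right hpq, hd]
    linarith [h.anti_of_le hpq hp, h0 p q]

theorem kernel_eq_of_le (D : ℕ → ℕ → ℝ) {N p q : ℕ} (hpq : p ≤ q) (hq : q ≤ N) :
    kernel D N p q = D p q := by
  rw [kernel_eq D (hpq.trans hq) hq, min_eq_left hpq]; ring

end Telescoping

/-! ### Lower bound on transport costs and its attainment. -/

section Cost

variable {π : ℕ → ℕ → ℝ}

theorem transportCost_eq (π : ℕ → ℕ → ℝ) (m n : ℕ) (z : ℕ → ℕ → ℝ) :
    transportCost π m n z = ∑ i ∈ Finset.range (m + 1), ∑ j ∈ Finset.range (n + 1),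
      z i j * shiftedDist π i j := by
  simp [transportCost, otDist]

theorem shiftedDist_succ_succ (π : ℕ → ℕ → ℝ) (m n : ℕ) :
    shiftedDist π (m + 1) (n + 1) =
      sInf {c : ℝ | ∃ z : ℕ → ℕ → ℝ, IsTransportPlan π m n z ∧ c = transportCost π m n z} := by
  have h := otDist_natCast π m n
  rwa [otDist, Int.toNat_natCast_add_one, Int.toNat_natCast_add_one] at h

theorem shiftedDist_zero_succ (π : ℕ → ℕ → ℝ) (n : ℕ) : shiftedDist π 0 (n + 1) = 1 := by
  simp [shiftedDist]

theorem shiftedDist_nonneg (π : ℕ → ℕ → ℝ) (a b : ℕ) : 0 ≤ shiftedDist π a b := by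
  induction a using Nat.strong_induction_on generalizing b with
  | _ a ih =>
    rcases a with _ | m <;> rcases b with _ | n
    · simp [shiftedDist]
    · simp [shiftedDist]
    · simp [shiftedDist]
    · rw [shiftedDist_succ_succ]
      refine Real.sInf_nonneg ?_
      rintro c ⟨z, hz, rfl⟩
      rw [transportCost_eq]
      exact Finset.sum_nonneg fun i hi => Finset.sum_nonneg fun j _ =>
        mul_nonneg (hz.nonneg i j) (ih i (Finset.mem_range.1 hi) j)

theorem transportCost_nonneg {m n : ℕ} {z : ℕ → ℕ → ℝ} (hz : IsTransportPlan π m n z) :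
    0 ≤ transportCost π m n z := by
  rw [transportCost_eq]
  exact Finset.sum_nonneg fun i _ => Finset.sum_nonneg fun j _ =>
    mul_nonneg (hz.nonneg i j) (shiftedDist_nonneg π i j)

theorem shiftedDist_le_transportCost {m n : ℕ} {z : ℕ → ℕ → ℝ} (hz : IsTransportPlan π m n z) :
    shiftedDist π (m + 1) (n + 1) ≤ transportCost π m n z := by
  rw [shiftedDist_succ_succ]
  refine csInf_le ⟨0, ?_⟩ ⟨z, hz, rfl⟩
  rintro c ⟨w, hw, rfl⟩
  exact transportCost_nonneg hw

theorem IsOptimalTransport.transportCost_eq_shiftedDist {m n : ℕ} {z : ℕ → ℕ → ℝ}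
    (hz : IsOptimalTransport π m n z) :
    transportCost π m n z = shiftedDist π (m + 1) (n + 1) := by
  refine le_antisymm ?_ (shiftedDist_le_transportCost hz.1)
  rw [shiftedDist_succ_succ]
  refine le_csInf ⟨_, z, hz.1, rfl⟩ ?_
  rintro c ⟨w, hw, rfl⟩
  exact hz.2 w hw

theorem shiftedDist_self (hπ : IsDistributionSequence π) (a : ℕ) : shiftedDist π a a = 0 := by
  induction a using Nat.strong_induction_on with
  | _ a ih =>
    rcases a with _ | m
    · simp [shiftedDist]
    · refine le_antisymm ?_ (shiftedDist_nonneg π _ _)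
      have hz : IsTransportPlan π m m fun i j => if i = j then π m i else 0 :=
        { nonneg := fun i j => by split_ifs; exacts [hπ.nonneg _ _, le_rfl]
          support := fun i j hij => by
            split_ifs with h
            · exact hπ.support m i (by omega)
            · rfl
          row_sum := fun i hi => by simp; omega
          col_sum := fun j hj => by simp; omega }
      refine (shiftedDist_le_transportCost hz).trans_eq ?_
      rw [transportCost_eq]
      refine Finset.sum_eq_zero fun i hi => Finset.sum_eq_zero fun j _ => ?_
      split_ifs with h
      · rw [← h, ih i (Finset.mem_range.1 hi), mul_zero]
      · exact zero_mul _

/-- The explicit optimal value of the transport problem from `π^m` to `π^n`. -/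
noncomputable def transportValue (π : ℕ → ℕ → ℝ) (N m n : ℕ) : ℝ :=
  ∑ q ∈ Finset.range (n + 1), π n q * shiftedDist π 0 q
    + ∑ p ∈ Finset.range (m + 1), π m p * shiftedDist π p N - shiftedDist π 0 N
    - ∑ i ∈ Finset.range N, ∑ j ∈ Finset.range N,
        mixedDiff (shiftedDist π) i j * min (upperMass π m i) (middleMass π n i j)

theorem IsTransportPlan.sum_kernel (hπ : IsDistributionSequence π) {m n : ℕ} {z : ℕ → ℕ → ℝ}
    (hz : IsTransportPlan π m n z) (D : ℕ → ℕ → ℝ) (N : ℕ) :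
    ∑ p ∈ Finset.range (m + 1), ∑ q ∈ Finset.range (n + 1), z p q * kernel D N p q =
      ∑ q ∈ Finset.range (n + 1), π n q * D 0 q
        + ∑ p ∈ Finset.range (m + 1), π m p * D p N - D 0 N
        - ∑ i ∈ Finset.range N, ∑ j ∈ Finset.range N, mixedDiff D i j * middleFlow m n z i j := by
  have h1 : ∑ p ∈ Finset.range (m + 1), ∑ q ∈ Finset.range (n + 1), z p q * D 0 q
      = ∑ q ∈ Finset.range (n + 1), π n q * D 0 q := by
    rw [Finset.sum_comm]
    refine Finset.sum_congr rfl fun q hq => ?_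
    rw [← Finset.sum_mul, hz.col_sum q (Nat.lt_succ_iff.1 (Finset.mem_range.1 hq))]
  have h2 : ∀ f : ℕ → ℝ, ∑ p ∈ Finset.range (m + 1), ∑ q ∈ Finset.range (n + 1), z p q * f p
      = ∑ p ∈ Finset.range (m + 1), π m p * f p := by
    intro f
    refine Finset.sum_congr rfl fun p hp => ?_
    rw [← Finset.sum_mul, hz.row_sum p (Nat.lt_succ_iff.1 (Finset.mem_range.1 hp))]
  have h3 : ∑ p ∈ Finset.range (m + 1), ∑ q ∈ Finset.range (n + 1), z p q * D 0 N = D 0 N := by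
    rw [h2 fun _ => D 0 N, ← Finset.sum_mul, hπ.sum_eq_one, one_mul]
  have h4 : ∑ p ∈ Finset.range (m + 1), ∑ q ∈ Finset.range (n + 1),
      z p q * (∑ i ∈ Finset.range N, ∑ j ∈ Finset.range N,
        if i < p ∧ i < q ∧ q ≤ j then mixedDiff D i j else 0)
      = ∑ i ∈ Finset.range N, ∑ j ∈ Finset.range N, mixedDiff D i j * middleFlow m n z i j := by
    simp only [middleFlow, Finset.mul_sum, mul_ite, mul_zero]
    rw [Finset.sum_congr rfl fun p _ => Finset.sum_comm, Finset.sum_comm]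
    refine Finset.sum_congr rfl fun i _ => ?_
    rw [Finset.sum_congr rfl fun p _ => Finset.sum_comm, Finset.sum_comm]
    simp only [mul_comm]
  simp only [kernel, mul_sub, mul_add, Finset.sum_sub_distrib, Finset.sum_add_distrib]
  rw [h1, h2 fun p => D p N, h3, h4]

theorem transportValue_le_transportCost (hπ : IsDistributionSequence π) {N : ℕ}
    (hN : QuadrangleUpTo (shiftedDist π) N) {m n : ℕ} (hm : m ≤ N) (hn : n ≤ N)
    {z : ℕ → ℕ → ℝ} (hz : IsTransportPlan π m n z) :
    transportValue π N m n ≤ transportCost π m n z := by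
  have h1 : ∑ p ∈ Finset.range (m + 1), ∑ q ∈ Finset.range (n + 1),
      z p q * kernel (shiftedDist π) N p q ≤ transportCost π m n z := by
    rw [transportCost_eq]
    refine Finset.sum_le_sum fun p hp => Finset.sum_le_sum fun q hq => ?_
    rw [Finset.mem_range] at hp hq
    exact mul_le_mul_of_nonneg_left (hN.kernel_le (shiftedDist_nonneg π) (shiftedDist_self hπ)
      (by omega) (by omega)) (hz.nonneg p q)
  refine le_trans ?_ h1
  rw [hz.sum_kernel hπ, transportValue]
  refine sub_le_sub_left (Finset.sum_le_sum fun i _ => Finset.sum_le_sum fun j hj => ?_) _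
  -- On and below the diagonal the sign of `mixedDiff` is unknown, but the interval `(i, j]` is
  -- empty there.
  by_cases hij : i < j
  · exact mul_le_mul_of_nonneg_left (hz.middleFlow_le i j)
      (hN.mixedDiff_nonneg i j hij (Finset.mem_range.1 hj))
  · have h2 : middleFlow m n z i j = 0 := Finset.sum_eq_zero fun p _ =>
      Finset.sum_eq_zero fun q _ => if_neg (by omega)
    rw [h2, middleMass_eq_zero (by omega), min_eq_right (upperMass_nonneg hπ _ _)]

theorem transportCost_insideOutPlan (hπ : IsDistributionSequence π) (hH : DriftCondition π)
    {N m n : ℕ} (hmn : m ≤ n) (hn : n ≤ N) :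
    transportCost π m n (insideOutPlan π m n) = transportValue π N m n := by
  have hz := isTransportPlan_insideOutPlan hπ hH hmn
  have h1 := hz.sum_kernel hπ (shiftedDist π) N
  simp only [middleFlow_insideOutPlan hπ hH hmn] at h1
  rw [transportValue, ← h1, transportCost_eq]
  refine Finset.sum_congr rfl fun p hp => Finset.sum_congr rfl fun q hq => ?_
  rw [Finset.mem_range] at hp hq
  by_cases h : insideOutPlan π m n p q = 0
  · rw [h, zero_mul, zero_mul]
  · have := insideOutPlan_support hπ hH hmn h
    rw [kernel_eq_of_le _ (by omega) (by omega)]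

theorem isOptimalTransport_insideOutPlan_of_quadrangle (hπ : IsDistributionSequence π)
    (hH : DriftCondition π) {N : ℕ} (hN : QuadrangleUpTo (shiftedDist π) N) {m n : ℕ}
    (hmn : m ≤ n) (hn : n ≤ N) : IsOptimalTransport π m n (insideOutPlan π m n) :=
  ⟨isTransportPlan_insideOutPlan hπ hH hmn, fun w hw => by
    rw [transportCost_insideOutPlan hπ hH hmn hn]
    exact transportValue_le_transportCost hπ hN (hmn.trans hn) hn hw⟩

theorem shiftedDist_eq_transportValue (hπ : IsDistributionSequence π)
    (hH : DriftCondition π) {N : ℕ} (hN : QuadrangleUpTo (shiftedDist π) N) {m n : ℕ}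
    (hmn : m ≤ n) (hn : n ≤ N) : shiftedDist π (m + 1) (n + 1) = transportValue π N m n := by
  rw [← transportCost_insideOutPlan hπ hH hmn hn,
    (isOptimalTransport_insideOutPlan_of_quadrangle hπ hH hN hmn hn).transportCost_eq_shiftedDist]

/-! ### Induction for the quadrangle inequality. -/

/-- The transport cost from `π^0`, all of whose mass sits at the node `0`. -/
theorem shiftedDist_one_succ (hπ : IsDistributionSequence π) (hH : DriftCondition π) {N : ℕ}
    (hN : QuadrangleUpTo (shiftedDist π) N) {n : ℕ} (hn : n ≤ N) :
    shiftedDist π 1 (n + 1) = 1 - π n 0 := by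
  have h0 : π 0 0 = 1 := by simpa using hπ.sum_eq_one 0
  have h1 := hπ.sum_eq_one n
  rw [Finset.sum_range_succ'] at h1
  rw [shiftedDist_eq_transportValue hπ hH hN (Nat.zero_le n) hn, transportValue]
  simp only [upperMass_eq_zero (Nat.zero_le _), min_eq_left (middleMass_nonneg hπ _ _ _), mul_zero,
    Finset.sum_const_zero, Finset.sum_range_succ', shiftedDist_zero_succ, mul_one,
    shiftedDist_self hπ, Finset.sum_range_zero, h0]
  linarith

theorem QuadrangleUpTo.succ (hπ : IsDistributionSequence π) (hH : DriftCondition π) {N : ℕ}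
    (hN : QuadrangleUpTo (shiftedDist π) N) : QuadrangleUpTo (shiftedDist π) (N + 1) where
  mixedDiff_nonneg i j hij hj := by
    obtain ⟨c, rfl⟩ : ∃ c, j = c + 1 := ⟨j - 1, by omega⟩
    -- The row `0` of the shifted cost is not a transport value; there the inequality reduces to (H)
    -- at the node `0`.
    rcases i with _ | a
    · have h := hH.le_of_le (Nat.zero_le c) (Nat.le_succ c)
      rw [mixedDiff, shiftedDist_one_succ hπ hH hN (by omega),
        shiftedDist_one_succ hπ hH hN (by omega), shiftedDist_zero_succ, shiftedDist_zero_succ]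
      linarith
    · rw [mixedDiff, shiftedDist_eq_transportValue hπ hH hN (m := a) (n := c) (by omega) (by omega),
        shiftedDist_eq_transportValue hπ hH hN (m := a + 1) (n := c + 1) (by omega) (by omega),
        shiftedDist_eq_transportValue hπ hH hN (m := a) (n := c + 1) (by omega) (by omega),
        shiftedDist_eq_transportValue hπ hH hN (m := a + 1) (n := c) (by omega) (by omega)]
      suffices h : ∑ i ∈ Finset.range N, ∑ j ∈ Finset.range N, mixedDiff (shiftedDist π) i j *
            (min (upperMass π a i) (middleMass π c i j)
              + min (upperMass π (a + 1) i) (middleMass π (c + 1) i j))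
          ≤ ∑ i ∈ Finset.range N, ∑ j ∈ Finset.range N, mixedDiff (shiftedDist π) i j *
            (min (upperMass π a i) (middleMass π (c + 1) i j)
              + min (upperMass π (a + 1) i) (middleMass π c i j)) by
        simp only [mul_add, Finset.sum_add_distrib] at h
        simp only [transportValue]
        linarith
      refine Finset.sum_le_sum fun i _ => Finset.sum_le_sum fun j hj => ?_
      by_cases h : i < j
      · exact mul_le_mul_of_nonneg_left (min_mass_supermodular hπ hH (by omega) i j)
          (hN.mixedDiff_nonneg i j h (Finset.mem_range.1 hj))
      · simp [middleMass_eq_zero (not_lt.1 h), upperMass_nonneg hπ]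
  anti i hi := by
    rcases i with _ | a
    · rw [shiftedDist_one_succ hπ hH hN le_rfl, shiftedDist_zero_succ]
      linarith [hπ.nonneg N 0]
    · rw [shiftedDist_eq_transportValue hπ hH hN (m := a) (by omega) le_rfl,
        shiftedDist_eq_transportValue hπ hH hN (m := a + 1) (by omega) le_rfl]
      have h1 : ∑ i ∈ Finset.range N, ∑ j ∈ Finset.range N,
            mixedDiff (shiftedDist π) i j * min (upperMass π a i) (middleMass π N i j)
          ≤ ∑ i ∈ Finset.range N, ∑ j ∈ Finset.range N,
            mixedDiff (shiftedDist π) i j * min (upperMass π (a + 1) i) (middleMass π N i j) := by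
        refine Finset.sum_le_sum fun i _ => Finset.sum_le_sum fun j hj => ?_
        by_cases h : i < j
        · exact mul_le_mul_of_nonneg_left (min_le_min_right _ (upperMass_le_succ hπ hH a i))
            (hN.mixedDiff_nonneg i j h (Finset.mem_range.1 hj))
        · simp [middleMass_eq_zero (not_lt.1 h), upperMass_nonneg hπ]
      -- From `π^a` to `π^{a+1}` mass only moves to the node `a + 1`, where `D(·, N)` is no larger;
      -- this controls the linear term of `transportValue`.
      have h2 : 0 ≤ ∑ p ∈ Finset.range (a + 1), (π a p - π (a + 1) p) *
          (shiftedDist π p N - shiftedDist π (a + 1) N) := by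
        refine Finset.sum_nonneg fun p hp => ?_
        rw [Finset.mem_range] at hp
        exact mul_nonneg (sub_nonneg.2 (hH.le_of_le (by omega) (Nat.le_succ a)))
          (sub_nonneg.2 (hN.anti_of_le (by omega) (by omega)))
      have h3 := hπ.sum_eq_one a
      have h4 := hπ.sum_eq_one (a + 1)
      rw [Finset.sum_range_succ] at h4
      simp only [sub_mul, mul_sub, Finset.sum_sub_distrib, ← Finset.sum_mul] at h2
      rw [h3] at h2
      simp only [transportValue]
      rw [Finset.sum_range_succ _ (a + 1)]
      rw [← eq_sub_iff_add_eq] at h4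
      rw [h4] at h2
      linarith

theorem quadrangleUpTo (hπ : IsDistributionSequence π) (hH : DriftCondition π) (N : ℕ) :
    QuadrangleUpTo (shiftedDist π) N := by
  induction N with
  | zero => exact ⟨fun i j _ h => absurd h (Nat.not_lt_zero j),
      fun i h => absurd h (Nat.not_lt_zero i)⟩
  | succ N ih => exact ih.succ hπ hH

/-- The elementary inequalities are summed over the rectangle `[i, j) × [k, l)`, which lies strictly
above the diagonal because `j ≤ k`. -/
theorem shiftedDist_quadrangle (hπ : IsDistributionSequence π) (hH : DriftCondition π)
    {i j k l : ℕ} (hij : i ≤ j) (hjk : j ≤ k) (hkl : k ≤ l) :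
    shiftedDist π i l + shiftedDist π j k ≤ shiftedDist π i k + shiftedDist π j l := by
  have step : ∀ i l, i < l →
      shiftedDist π i (l + 1) - shiftedDist π i l
        ≤ shiftedDist π (i + 1) (l + 1) - shiftedDist π (i + 1) l := by
    intro i l hil
    have := (quadrangleUpTo hπ hH (l + 1)).mixedDiff_nonneg i l hil (Nat.lt_succ_self l)
    rw [mixedDiff] at this
    linarith
  have row : ∀ l, j ≤ l → shiftedDist π i (l + 1) - shiftedDist π i l
      ≤ shiftedDist π j (l + 1) - shiftedDist π j l := by
    induction j, hij using Nat.le_induction with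
    | base => exact fun _ _ => le_rfl
    | succ j _ ih => exact fun l hl => (ih (by omega) l (by omega)).trans (step j l (by omega))
  induction l, hkl using Nat.le_induction with
  | base => exact le_rfl
  | succ l _ ih => linarith [row l (by omega)]

end Cost

theorem mainTheorem4 (π : ℕ → ℕ → ℝ) (hπ : IsDistributionSequence π) (hH : DriftCondition π) :
    (∀ i j k l : ℤ, -1 ≤ i → i ≤ j → j ≤ k → k ≤ l →
      otDist π i l + otDist π j k ≤ otDist π i k + otDist π j l) ∧
    (∀ m n : ℕ, m ≤ n →
      IsOptimalTransport π m n (insideOutPlan π m n) ∧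
      transportCost π m n (insideOutPlan π m n) = otDist π m n ∧
      IsSimplePlan π m n (insideOutPlan π m n) ∧
      IsNestedPlan (insideOutPlan π m n)) := by
  refine ⟨fun i j k l _ hij hjk hkl => shiftedDist_quadrangle hπ hH (by omega) (by omega)
    (by omega), fun m n hmn => ?_⟩
  have hopt := isOptimalTransport_insideOutPlan_of_quadrangle hπ hH (quadrangleUpTo hπ hH n)
    hmn le_rfl
  refine ⟨hopt, ?_, isSimplePlan_insideOutPlan hπ hH hmn, isNestedPlan_insideOutPlan hπ hH hmn⟩
  rw [hopt.transportCost_eq_shiftedDist, otDist, Int.toNat_natCast_add_one,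
    Int.toNat_natCast_add_one]
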